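/- For a compact set $E\subset\mathbb{C}$ let $\|f\|_E=\sup_{z\in E}|f(z)|$, and let the logarithmic capacity of $E$ be $\mathrm{cap}(E)=e^{-V(E)}$, where $V(E)=\inf_\mu \iint \log\frac{1}{|z-t|}\,d\mu(z)\,d\mu(t)$, the infimum being over all Borel probability measures $\mu$ supported in $E$ (and $e^{-\infty}=0$). An $n$-th integer Chebyshev polynomial for $E$ is a nonzero polynomial $Q_n$ with integer coefficients and degree at most $n$ such that $\|Q_n\|_E\le\|P\|_E$ for every nonzero polynomial $P$ with integer coefficients and degree at most $n$. **Theorem 1.5.** Let $E\subset\mathbb{R}$ be an infinite compact set with $\mathrm{cap}(E)<1$. For each $n\ge 1$ let $Q_n$ be any $n$-th integer Chebyshev polynomial for $E$. Then the polynomials $Q_n$, $n\ge1$, together have infinitely many distinct non-constant irreducible factors: the set of non-constant irreducible $F\in\mathbb{Z}[x]$ such that $F$ divides $Q_n$ in $\mathbb{Z}[x]$ for some $n\ge1$ is infinite. -/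

import Mathlib

open Polynomial MeasureTheory

noncomputable section

/-- The logarithmic energy `∬ log (1 / |z - t|) dμ(z) dμ(t)` of a measure on the plane, as an
extended real number: the integral of the positive part of the kernel minus the integral of its
negative part.  The kernel is `+∞` on the diagonal, because `ENNReal.log 0 = ⊥`; the function
`EReal.toENNReal` sends negative values to `0`.  If `μ` is finite with bounded support, then the
second integral is finite. -/
def logEnergy (μ : Measure ℂ) : EReal :=
  ((∫⁻ z, ∫⁻ t, (-ENNReal.log ‖z - t‖ₑ).toENNReal ∂μ ∂μ : ENNReal) : EReal) -
    ((∫⁻ z, ∫⁻ t, (ENNReal.log ‖z - t‖ₑ).toENNReal ∂μ ∂μ : ENNReal) : EReal)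

/-- The infimum of the logarithmic energies of the Borel probability measures carried by `E`
(for closed `E`: whose support is contained in `E`). -/
def robinConstant (E : Set ℂ) : EReal :=
  ⨅ (μ : Measure ℂ) (_ : IsProbabilityMeasure μ) (_ : μ Eᶜ = 0), logEnergy μ

/-- The logarithmic capacity `exp (-V)` of a compact plane set, where `V` is the infimum of the
logarithmic energies (with `exp (-∞) = 0`). -/
def logCapacity (E : Set ℂ) : ENNReal :=
  EReal.exp (-robinConstant E)

/-- The supremum norm on `E ⊆ ℂ` of a polynomial with integer coefficients. -/
def polySupNorm (E : Set ℂ) (P : ℤ[X]) : ℝ :=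
  sSup ((fun z : ℂ => ‖aeval z P‖) '' E)

/-- `Q` is an `n`-th integer Chebyshev polynomial for `E`: it has the smallest supremum norm on
`E` among all nonzero polynomials of degree at most `n` with integer coefficients. -/
def IsIntegerChebyshev (E : Set ℂ) (n : ℕ) (Q : ℤ[X]) : Prop :=
  Q ≠ 0 ∧ Q.natDegree ≤ n ∧
    ∀ P : ℤ[X], P ≠ 0 → P.natDegree ≤ n → polySupNorm E Q ≤ polySupNorm E P

end

/-! Suppose that only finitely many non-constant irreducible factors `F i` occur, and let `t` be the
infimum of `‖Q_n‖^(1/n)`. By minimality of the `Q_n`, every nonzero integer polynomial of degree at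
most `N ≥ 1` has norm at least `t ^ N` on `E`. Conversely, the normalised multiplicities in the
`Q_n` form a bounded family of exponents, and a limit point `α` gives `g = ∏ |F i| ^ α i ≤ t` on `E`
away from the zeros of the `F i`, with `∑ α i * deg F i ≤ 1`. Since `E` is infinite, `t > 0`.

Capacity below one gives `t < 1`: products of differences of `n` points of `E` are at most `exp (-c
n²)`, so Minkowski's theorem at Fekete points produces a nonzero integer polynomial with values
below 1 on `E`.

The contradiction is a perturbation of `g`. As `t ≠ 1`, the equation `g = t` has only finitely many
solutions off the zeros of the `F i`. Minkowski's theorem again gives an integer polynomial `P` so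
small there that a root `h` of `|P| * ∏ |F i|`, normalised by degree, is below `t` at those lying in
`E`. The lower bound extends to real exponents, so `h ^ ε * g ^ (1 - ε)` reaches `t` at some point
of `E`. There `g ≤ t` forces `h ≥ t`; at a limit point as `ε → 0` both `g = t` and `h ≥ t` hold,
which is impossible. -/

/-! ### Geometry of numbers and Fekete points. -/

theorem exists_int_vector_mulVec_lt {n : ℕ} (M : Matrix (Fin n) (Fin n) ℝ) (hM : M.det ≠ 0)
    (c : Fin n → ℝ) (hc : ∀ i, 0 < c i) (h : |M.det| < ∏ i, c i) :
    ∃ a : Fin n → ℤ, a ≠ 0 ∧ ∀ i, |M.mulVec (fun j => (a j : ℝ)) i| < c i := by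
  set b := Pi.basisFun ℝ (Fin n)
  set s : Set (Fin n → ℝ) := Set.univ.pi fun i => Set.Ioo (-c i) (c i) with hs
  set f : (Fin n → ℝ) →ₗ[ℝ] (Fin n → ℝ) := Matrix.toLin' M with hf
  have hdet : LinearMap.det f = M.det := LinearMap.det_toLin' M
  have hfd := ZSpan.isAddFundamentalDomain' b (volume : Measure (Fin n → ℝ))
  have hvol : volume (ZSpan.fundamentalDomain b) = 1 := by
    rw [ZSpan.fundamentalDomain_pi_basisFun, volume_pi_pi]; simp
  have hconv : Convex ℝ (f ⁻¹' s) :=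
    (convex_pi fun i _ => convex_Ioo _ _).linear_preimage f
  have hsymm : ∀ x ∈ f ⁻¹' s, -x ∈ f ⁻¹' s := by
    intro x hx i hi
    have := hx i hi
    simp only [map_neg, Pi.neg_apply, Set.mem_Ioo] at this ⊢
    constructor <;> linarith [this.1, this.2]
  have hlt : volume (ZSpan.fundamentalDomain b) * 2 ^ Module.finrank ℝ (Fin n → ℝ)
      < volume (f ⁻¹' s) := by
    -- The preimage of the box has volume `2 ^ n * ∏ c i / |det M|`, and Minkowski's convex body
    -- theorem needs more than `2 ^ n`.
    rw [Measure.addHaar_preimage_linearMap _ (by rwa [hdet]), hvol, hdet, hs, volume_pi_pi]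
    simp only [Real.volume_Ioo, Module.finrank_fin_fun, one_mul, sub_neg_eq_add]
    rw [← ENNReal.ofReal_prod_of_nonneg (fun i _ => by linarith [hc i]),
      ← ENNReal.ofReal_mul (abs_nonneg _)]
    have h2 : ∏ i, (c i + c i) = 2 ^ n * ∏ i, c i := by
      simp_rw [← two_mul]; rw [Finset.prod_mul_distrib]; simp
    have h3 : (2 : ENNReal) ^ n = ENNReal.ofReal (2 ^ n) := by
      rw [ENNReal.ofReal_pow (by norm_num)]; simp
    rw [h3, h2, abs_inv]
    apply (ENNReal.ofReal_lt_ofReal_iff_of_nonneg (by positivity)).2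
    rw [mul_left_comm, lt_mul_iff_one_lt_right (by positivity), ← div_eq_inv_mul,
      one_lt_div (abs_pos.2 hM)]
    exact h
  have : Countable (Submodule.span ℤ (Set.range b)).toAddSubgroup :=
    inferInstanceAs (Countable (Submodule.span ℤ (Set.range b)))
  obtain ⟨⟨x, hx⟩, hx0, hxs⟩ := exists_ne_zero_mem_lattice_of_measure_mul_two_pow_lt_measure
    hfd hsymm hconv hlt
  have hx' := (Module.Basis.mem_span_iff_repr_mem ℤ b x).1 hx
  choose a ha using hx'
  have hax : (fun j => (a j : ℝ)) = x := by
    funext j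
    simpa [b] using ha j
  refine ⟨a, ?_, fun i => ?_⟩
  · rintro rfl
    apply hx0
    ext j
    simp [← hax]
  · rw [hax]
    have := hxs i (Set.mem_univ i)
    simp only [hf, Matrix.toLin'_apply, Set.mem_Ioo] at this
    exact abs_lt.2 this

/-- Minkowski's linear forms theorem for the values of an integer polynomial. -/
theorem exists_int_polynomial_lt_of_det_vandermonde {n : ℕ} {v : Fin n → ℝ}
    (hv : Function.Injective v) {c : Fin n → ℝ} (hc : ∀ i, 0 < c i)
    (h : |(Matrix.vandermonde v).det| < ∏ i, c i) :
    ∃ P : ℤ[X], P ≠ 0 ∧ P.natDegree < n ∧ (∀ i, |aeval (v i) P| < c i) := by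
  obtain ⟨a, ha0, ha⟩ := exists_int_vector_mulVec_lt (Matrix.vandermonde v)
    (Matrix.det_vandermonde_ne_zero_iff.2 hv) c hc h
  have hn : n ≠ 0 := by
    rintro rfl
    exact ha0 (Subsingleton.elim _ _)
  have hPdeg : (∑ j : Fin n, C (a j) * X ^ (j : ℕ) : ℤ[X]).natDegree < n := by
    refine lt_of_le_of_lt (natDegree_sum_le_of_forall_le (n := n - 1) _ _ fun j _ => ?_) (by omega)
    exact (natDegree_C_mul_X_pow_le _ _).trans (by omega)
  refine ⟨∑ j : Fin n, C (a j) * X ^ (j : ℕ), ?_, hPdeg, ?_⟩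
  · intro h0
    apply ha0
    funext j
    have := congrArg (fun p => p.coeff (j : ℕ)) h0
    simpa [finsetSum_coeff, coeff_C_mul, coeff_X_pow, Fin.val_inj] using this
  · intro i
    convert ha i using 2
    simp [Matrix.mulVec, dotProduct, Matrix.vandermonde_apply, mul_comm]

/-- Interpolation of a polynomial at real nodes, without denominators. -/
theorem det_vandermonde_mul_aeval {n : ℕ} (v : Fin n → ℝ) {P : ℤ[X]} (hP : P.natDegree < n)
    (x : ℝ) : (Matrix.vandermonde v).det * aeval x P =
      ∑ i, (Matrix.vandermonde (Function.update v i x)).det * aeval (v i) P := by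
  set V := Matrix.vandermonde v
  set r : Fin n → ℝ := fun j => x ^ (j : ℕ)
  set a : Fin n → ℝ := fun j => (P.coeff j : ℝ)
  have hev : ∀ y : ℝ, aeval y P = ∑ j : Fin n, y ^ (j : ℕ) * a j := by
    intro y
    rw [aeval_eq_sum_range' hP, Finset.sum_range]
    simp [a, mul_comm]
  have hup : ∀ i, (Matrix.vandermonde (Function.update v i x)) = V.updateRow i r := by
    intro i
    ext k j
    by_cases hk : k = i
    · subst hk; simp [Matrix.vandermonde_apply, r]
    · simp [Matrix.vandermonde_apply, hk, V]
  have hcr := Matrix.mulVec_cramer V.transpose r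
  have h1 : aeval x P = r ⬝ᵥ a := by rw [hev]; rfl
  have h2 : ∀ i, aeval (v i) P = (V.mulVec a) i := by
    intro i; rw [hev]; rfl
  calc V.det * aeval x P = (V.transpose.det • r) ⬝ᵥ a := by
        rw [h1, smul_dotProduct, Matrix.det_transpose, smul_eq_mul]
    _ = (Matrix.cramer V.transpose r) ⬝ᵥ (V.mulVec a) := by
        rw [← hcr, Matrix.mulVec_transpose, Matrix.dotProduct_mulVec]
    _ = _ := by
        simp only [dotProduct, Matrix.cramer_transpose_apply, hup, h2]

/-- Fekete points: nodes at which the values of a polynomial control its supremum. -/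
theorem exists_fekete_points {E : Set ℝ} (hE : IsCompact E) (hinf : E.Infinite) (n : ℕ) :
    ∃ v : Fin n → ℝ, Function.Injective v ∧ (∀ i, v i ∈ E) ∧
      ∀ P : ℤ[X], P.natDegree < n → ∀ x ∈ E, |aeval x P| ≤ ∑ i, |aeval (v i) P| := by
  obtain ⟨w, hw⟩ : ∃ w : Fin n → ℝ, Function.Injective w ∧ ∀ i, w i ∈ E := by
    obtain ⟨t, htE, htn⟩ := hinf.exists_subset_card_eq n
    refine ⟨fun i => (t.equivFin.symm (Fin.cast htn.symm i) : ℝ), ?_, fun i => htE ?_⟩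
    · intro i j hij
      simpa [Subtype.val_inj] using hij
    · exact (t.equivFin.symm (Fin.cast htn.symm i)).2
  have hcont : Continuous fun v : Fin n → ℝ => |(Matrix.vandermonde v).det| := by
    simp_rw [Matrix.det_vandermonde]
    fun_prop
  obtain ⟨v, hvE, hv⟩ := (isCompact_univ_pi fun _ : Fin n => hE).exists_isMaxOn
    ⟨w, fun i _ => hw.2 i⟩ hcont.continuousOn
  have hpos : 0 < |(Matrix.vandermonde v).det| :=
    lt_of_lt_of_le (abs_pos.2 (Matrix.det_vandermonde_ne_zero_iff.2 hw.1))
      (hv (fun i _ => hw.2 i : w ∈ Set.univ.pi fun _ => E))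
  refine ⟨v, Matrix.det_vandermonde_ne_zero_iff.1 (abs_pos.1 hpos), fun i => hvE i trivial, ?_⟩
  intro P hP x hx
  refine le_of_mul_le_mul_left ?_ hpos
  rw [← abs_mul, det_vandermonde_mul_aeval v hP, Finset.mul_sum]
  refine (Finset.abs_sum_le_sum_abs _ _).trans (Finset.sum_le_sum fun i _ => ?_)
  rw [abs_mul]
  -- Replacing one node by `x` stays in `E`, so maximality of the Vandermonde determinant bounds
  -- each Lagrange coefficient by 1.
  refine mul_le_mul_of_nonneg_right (hv ?_) (abs_nonneg _)
  intro j _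
  by_cases hj : j = i
  · subst hj; simpa using hx
  · simpa [hj] using hvE j trivial

/-- An integer polynomial that is small at the points of a finite set of reals. -/
theorem exists_int_polynomial_lt_on_finset (S : Finset ℝ) {τ : ℝ} (hτ : 0 < τ) :
    ∃ P : ℤ[X], P ≠ 0 ∧ P.natDegree ≤ S.card ∧ ∀ x ∈ S, |aeval x P| < τ := by
  obtain ⟨y, hy⟩ := Infinite.exists_notMem_finset S
  set e := S.equivFin.symm
  set v : Fin (S.card + 1) → ℝ := Fin.cons y fun i => (e i : ℝ)
  have hv : Function.Injective v := by
    refine Fin.cons_injective_iff.2 ⟨?_, Subtype.val_injective.comp e.injective⟩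
    rintro ⟨i, hi⟩
    exact hy (hi ▸ (e i).2)
  set Δ := |(Matrix.vandermonde v).det|
  -- The bound at the auxiliary node `y` is irrelevant; it is chosen to make the product of all
  -- bounds `Δ + 1`.
  set c : Fin (S.card + 1) → ℝ := Fin.cons ((Δ + 1) / τ ^ S.card) fun _ => τ
  have hc : ∀ i, 0 < c i := by
    refine Fin.cases ?_ fun i => ?_
    · simp only [c, Fin.cons_zero]; positivity
    · simpa [c] using hτ
  obtain ⟨P, hP0, hPd, hP⟩ := exists_int_polynomial_lt_of_det_vandermonde hv hc (by
    rw [Fin.prod_univ_succ]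
    simp only [c, Fin.cons_zero, Fin.cons_succ, Finset.prod_const, Finset.card_univ,
      Fintype.card_fin]
    rw [div_mul_cancel₀ _ (by positivity)]
    exact lt_add_one _)
  refine ⟨P, hP0, by omega, fun x hx => ?_⟩
  have := hP (e.symm ⟨x, hx⟩).succ
  simpa [v, c] using this

/-! ### Logarithmic energy, transfinite diameter and the Hilbert–Fekete theorem. -/

/-- The kernel `log (1 / |z - t|)` truncated from above at the height `M`. -/
noncomputable def truncLogKernel (M : ℕ) (p : ℂ × ℂ) : ℝ :=
  -Real.log (max ‖p.1 - p.2‖ (Real.exp (-M)))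

theorem continuous_truncLogKernel (M : ℕ) : Continuous (truncLogKernel M) := by
  unfold truncLogKernel
  refine (Continuous.log (by fun_prop) fun p => ?_).neg
  exact (lt_max_of_lt_right (Real.exp_pos _)).ne'

theorem truncLogKernel_le (M : ℕ) (p : ℂ × ℂ) : truncLogKernel M p ≤ M := by
  unfold truncLogKernel
  have := Real.log_le_log (Real.exp_pos _) (le_max_right ‖p.1 - p.2‖ (Real.exp (-M)))
  rw [Real.log_exp] at this
  linarith

theorem truncLogKernel_le_neg_log (M : ℕ) {p : ℂ × ℂ} (hp : p.1 ≠ p.2) :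
    truncLogKernel M p ≤ -Real.log ‖p.1 - p.2‖ := by
  unfold truncLogKernel
  exact neg_le_neg (Real.log_le_log (norm_pos_iff.2 (sub_ne_zero.2 hp)) (le_max_left _ _))

theorem ofReal_neg_truncLogKernel (M : ℕ) (p : ℂ × ℂ) :
    ENNReal.ofReal (-truncLogKernel M p) = (ENNReal.log ‖p.1 - p.2‖ₑ).toENNReal := by
  unfold truncLogKernel
  rw [neg_neg]
  have hM : Real.exp (-M) ≤ 1 := Real.exp_le_one_iff.2 (by simp)
  rcases le_or_gt ‖p.1 - p.2‖ 1 with h | h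
  · rw [EReal.toENNReal_of_nonpos, ENNReal.ofReal_of_nonpos]
    · exact Real.log_nonpos (le_max_of_le_right (Real.exp_pos _).le) (max_le h hM)
    · rw [ENNReal.log_le_zero_iff, ← ofReal_norm]
      exact ENNReal.ofReal_le_one.2 h
  · rw [max_eq_left (hM.trans h.le), ← ofReal_norm,
      ENNReal.log_ofReal_of_pos (zero_lt_one.trans h), EReal.toENNReal_of_ne_top (by simp),
      EReal.toReal_coe]

theorem iSup_ofReal_truncLogKernel (p : ℂ × ℂ) :
    ⨆ M, ENNReal.ofReal (truncLogKernel M p) = (-ENNReal.log ‖p.1 - p.2‖ₑ).toENNReal := by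
  unfold truncLogKernel
  rcases eq_or_ne (p.1 - p.2) 0 with h | h
  · rw [h]
    simp only [norm_zero, enorm_zero, ENNReal.log_zero, EReal.neg_bot, EReal.toENNReal_top]
    simp_rw [max_eq_right (Real.exp_pos _).le, Real.log_exp, neg_neg, ENNReal.ofReal_natCast]
    exact ENNReal.iSup_natCast
  · have hpos : 0 < ‖p.1 - p.2‖ := norm_pos_iff.2 h
    rw [← ofReal_norm, ENNReal.log_ofReal_of_pos hpos, ← EReal.coe_neg,
      EReal.toENNReal_of_ne_top (by simp), EReal.toReal_coe]
    apply le_antisymm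
    · exact iSup_le fun M => ENNReal.ofReal_le_ofReal
        (neg_le_neg (Real.log_le_log hpos (le_max_left _ _)))
    · obtain ⟨M, hM⟩ := exists_nat_ge (-Real.log ‖p.1 - p.2‖)
      refine le_iSup_of_le M ?_
      rw [max_eq_left]
      rw [← Real.exp_log hpos]
      exact Real.exp_le_exp.2 (by linarith)

theorem monotone_truncLogKernel (p : ℂ × ℂ) : Monotone fun M => truncLogKernel M p := by
  intro M N h
  refine neg_le_neg (Real.log_le_log (lt_max_of_lt_right (Real.exp_pos _)) ?_)
  refine max_le_max_left _ (Real.exp_le_exp.2 ?_)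
  exact neg_le_neg (Nat.cast_le.2 h)

/-- Truncation leaves the negative part of the kernel unchanged, and its integral is finite on a
compact set; the positive parts increase with `M`, so monotone convergence applies. -/
theorem logEnergy_le_of_forall_truncLogKernel {K : Set ℂ} (hK : IsCompact K) {μ : Measure ℂ}
    [IsProbabilityMeasure μ] (hμ : μ Kᶜ = 0) {b : ℝ}
    (h : ∀ M, ∫ p, truncLogKernel M p ∂(μ.prod μ) ≤ b) : logEnergy μ ≤ b := by
  have hmem : ∀ᵐ p ∂(μ.prod μ), p ∈ K ×ˢ K := by
    have hK1 : ∀ᵐ z ∂μ, z ∈ K := hμ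
    filter_upwards [Measure.quasiMeasurePreserving_fst.ae hK1,
      Measure.quasiMeasurePreserving_snd.ae hK1] with p h1 h2 using ⟨h1, h2⟩
  have hint : ∀ M, Integrable (truncLogKernel M) (μ.prod μ) := by
    intro M
    obtain ⟨C, hC⟩ := (hK.prod hK).exists_bound_of_continuousOn
      (continuous_truncLogKernel M).continuousOn
    exact Integrable.of_bound (continuous_truncLogKernel M).aestronglyMeasurable C
      (hmem.mono hC)
  have hmeas : ∀ M, Measurable fun p => ENNReal.ofReal (truncLogKernel M p) := fun M =>
    (continuous_truncLogKernel M).measurable.ennreal_ofReal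
  have hneg : ∫⁻ z, ∫⁻ t, (ENNReal.log ‖z - t‖ₑ).toENNReal ∂μ ∂μ =
      ∫⁻ p, ENNReal.ofReal (-truncLogKernel 0 p) ∂(μ.prod μ) := by
    have hm : Measurable fun p => ENNReal.ofReal (-truncLogKernel 0 p) :=
      (continuous_truncLogKernel 0).neg.measurable.ennreal_ofReal
    rw [lintegral_prod _ hm.aemeasurable]
    simp_rw [ofReal_neg_truncLogKernel]
  have hpos : ∫⁻ z, ∫⁻ t, (-ENNReal.log ‖z - t‖ₑ).toENNReal ∂μ ∂μ =
      ⨆ M, ∫⁻ p, ENNReal.ofReal (truncLogKernel M p) ∂(μ.prod μ) := by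
    rw [← lintegral_iSup hmeas fun M N hMN p =>
      ENNReal.ofReal_le_ofReal (monotone_truncLogKernel p hMN),
      lintegral_prod _ (Measurable.iSup hmeas).aemeasurable]
    simp_rw [iSup_ofReal_truncLogKernel]
  have hfin : ∫⁻ p, ENNReal.ofReal (-truncLogKernel 0 p) ∂(μ.prod μ) ≠ ⊤ :=
    (hint 0).neg.lintegral_lt_top.ne
  rw [logEnergy, hpos, hneg]
  set B := ∫⁻ p, ENNReal.ofReal (-truncLogKernel 0 p) ∂(μ.prod μ)
  have hB : ∀ M, ∫⁻ p, ENNReal.ofReal (-truncLogKernel M p) ∂(μ.prod μ) = B := by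
    intro M
    simp_rw [B, ofReal_neg_truncLogKernel]
  have key : ∀ M, ∫⁻ p, ENNReal.ofReal (truncLogKernel M p) ∂(μ.prod μ) ≤
      ENNReal.ofReal (b + B.toReal) := by
    intro M
    have h1 := h M
    rw [integral_eq_lintegral_pos_part_sub_lintegral_neg_part (hint M), hB M] at h1
    rw [← ENNReal.ofReal_toReal (hint M).lintegral_lt_top.ne]
    exact ENNReal.ofReal_le_ofReal (by linarith)
  have hb : 0 ≤ b + B.toReal := by
    have h1 := h 0
    rw [integral_eq_lintegral_pos_part_sub_lintegral_neg_part (hint 0), hB 0] at h1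
    have := ENNReal.toReal_nonneg
      (a := ∫⁻ p, ENNReal.ofReal (truncLogKernel 0 p) ∂(μ.prod μ))
    linarith
  have h3 := EReal.coe_ennreal_le_coe_ennreal_iff.2 (iSup_le key)
  rw [EReal.coe_ennreal_ofReal, max_eq_left hb] at h3
  have hBr : ((B : ENNReal) : EReal) = (B.toReal : EReal) :=
    (EReal.coe_ennreal_toReal hfin).symm
  rw [hBr]
  rw [EReal.sub_le_iff_le_add (by simp) (by simp)]
  rw [← EReal.coe_add]
  exact h3

/-- The normalised counting measure of a finite family of points. -/
noncomputable def empiricalMeasure {X : Type*} [MeasurableSpace X] {n : ℕ} (v : Fin n → X) :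
    Measure X :=
  (n : ENNReal)⁻¹ • ∑ i, Measure.dirac (v i)

theorem isProbabilityMeasure_empiricalMeasure {X : Type*} [MeasurableSpace X] {n : ℕ}
    (hn : n ≠ 0) (v : Fin n → X) : IsProbabilityMeasure (empiricalMeasure v) := by
  constructor
  simp only [empiricalMeasure, Measure.smul_apply, Measure.finsetSum_apply, measure_univ,
    Finset.sum_const, Finset.card_univ, Fintype.card_fin, nsmul_eq_mul, mul_one, smul_eq_mul]
  exact ENNReal.inv_mul_cancel (by simpa using hn) (by simp)

theorem integral_empiricalMeasure {X : Type*} [MeasurableSpace X] [MeasurableSingletonClass X]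
    {n : ℕ} (v : Fin n → X) (f : X → ℝ) :
    ∫ x, f x ∂(empiricalMeasure v) = (n : ℝ)⁻¹ * ∑ i, f (v i) := by
  rw [empiricalMeasure, integral_smul_measure, integral_finsetSum_measure]
  · simp
  · intro i _
    exact integrable_dirac (by simp)

/-- Each diagonal term costs at most `M`, which is why the kernel is truncated; each off-diagonal
pair is counted twice. -/
theorem sum_truncLogKernel_le (M : ℕ) {n : ℕ} {v : Fin n → ℂ} {c : ℝ}
    (h : Real.exp (-c) < ∏ i, ∏ j ∈ Finset.Ioi i, ‖v j - v i‖) :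
    ∑ i, ∑ j, truncLogKernel M (v i, v j) ≤ n * M + 2 * c := by
  have hne : ∀ i, ∀ j ∈ Finset.Ioi i, ‖v j - v i‖ ≠ 0 := by
    intro i j hj h0
    rw [Finset.prod_eq_zero (Finset.mem_univ i) (Finset.prod_eq_zero hj h0)] at h
    exact absurd h (Real.exp_pos _).le.not_gt
  have hlog : -c < ∑ i, ∑ j ∈ Finset.Ioi i, Real.log ‖v j - v i‖ := by
    have := Real.log_lt_log (Real.exp_pos _) h
    rwa [Real.log_exp, Real.log_prod fun i _ => Finset.prod_ne_zero_iff.2 (hne i),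
      Finset.sum_congr rfl fun i _ => Real.log_prod (hne i)] at this
  have hsplit : ∑ i, ∑ j, truncLogKernel M (v i, v j) =
      ∑ i, truncLogKernel M (v i, v i) +
        ∑ i, ∑ j ∈ Finset.Ioi i, (truncLogKernel M (v i, v j) + truncLogKernel M (v j, v i)) := by
    rw [Finset.sum_sum_Ioi_add_eq_sum_sum_off_diag (fun i j => truncLogKernel M (v j, v i)),
      ← Finset.sum_add_distrib]
    refine Finset.sum_congr rfl fun i _ => ?_
    exact Fintype.sum_eq_add_sum_compl i fun j => truncLogKernel M (v i, v j)
  have h1 : ∑ i, truncLogKernel M (v i, v i) ≤ n * M := by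
    refine (Finset.sum_le_sum fun i _ => truncLogKernel_le M (v i, v i)).trans ?_
    simp
  have h2 : ∑ i, ∑ j ∈ Finset.Ioi i,
      (truncLogKernel M (v i, v j) + truncLogKernel M (v j, v i)) ≤
      ∑ i, ∑ j ∈ Finset.Ioi i, (-2) * Real.log ‖v j - v i‖ := by
    refine Finset.sum_le_sum fun i _ => Finset.sum_le_sum fun j hj => ?_
    have hij : v j ≠ v i := sub_ne_zero.1 (norm_ne_zero_iff.1 (hne i j hj))
    have h3 := truncLogKernel_le_neg_log M (p := (v i, v j)) hij.symm
    have h4 := truncLogKernel_le_neg_log M (p := (v j, v i)) hij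
    rw [norm_sub_rev] at h3
    simp only at h3 h4
    linarith
  simp_rw [← Finset.mul_sum] at h2
  linarith

/-- If the Robin constant is positive then the transfinite diameter is smaller than one. -/
theorem exists_prod_norm_sub_le_of_robinConstant_pos {K : Set ℂ} (hK : IsCompact K)
    (h : 0 < robinConstant K) :
    ∃ c : ℝ, 0 < c ∧ ∃ N : ℕ, ∀ n ≥ N, ∀ v : Fin n → ℂ, (∀ i, v i ∈ K) →
      ∏ i, ∏ j ∈ Finset.Ioi i, ‖v j - v i‖ ≤ Real.exp (-(c * n ^ 2)) := by
  obtain ⟨b, hb0, hb⟩ := EReal.lt_iff_exists_real_btwn.1 h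
  have hb0' : 0 < b := by exact_mod_cast hb0
  refine ⟨b / 2, half_pos hb0', ?_⟩
  by_contra! hcon
  choose m hm v hvK hv using fun N => hcon (N + 1)
  have : CompactSpace K := isCompact_iff_compactSpace.1 hK
  let w : ∀ N, Fin (m N) → K := fun N i => ⟨v N i, hvK N i⟩
  have hm0 : ∀ N, m N ≠ 0 := fun N => by have := hm N; omega
  let μ : ℕ → ProbabilityMeasure K := fun N =>
    ⟨empiricalMeasure (w N), isProbabilityMeasure_empiricalMeasure (hm0 N) _⟩
  -- Weak compactness of the probability measures on `K` yields a limit of the counting measures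
  -- along an ultrafilter; its energy will be at most `b`.
  obtain ⟨ν, -, hν⟩ := isCompact_univ.ultrafilter_le_nhds
    ((Filter.hyperfilter ℕ).map μ) (by simp)
  have hlim : Filter.Tendsto μ (Filter.hyperfilter ℕ) (nhds ν) := hν
  have hprod : Filter.Tendsto (fun N => (μ N).prod (μ N)) (Filter.hyperfilter ℕ)
      (nhds (ν.prod ν)) :=
    (ProbabilityMeasure.continuous_prod.tendsto (ν, ν)).comp (hlim.prodMk_nhds hlim)
  let ν' : Measure ℂ := (ν : Measure K).map Subtype.val
  have hν'p : IsProbabilityMeasure ν' :=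
    Measure.isProbabilityMeasure_map measurable_subtype_coe.aemeasurable
  have hν'K : ν' Kᶜ = 0 := by
    rw [Measure.map_apply measurable_subtype_coe hK.measurableSet.compl]
    simp
  have hkey : ∀ M, ∫ p, truncLogKernel M p ∂(ν'.prod ν') ≤ b := by
    intro M
    let f : C(K × K, ℝ) := ⟨fun p => truncLogKernel M (p.1, p.2),
      (continuous_truncLogKernel M).comp (by fun_prop)⟩
    have h1 := (ProbabilityMeasure.tendsto_iff_forall_integral_tendsto.1 hprod)
      (BoundedContinuousFunction.mkOfCompact f)
    have h2 : ∫ p, truncLogKernel M p ∂(ν'.prod ν') = ∫ p, f p ∂((ν : Measure K).prod ν) := by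
      rw [Measure.map_prod_map _ _ measurable_subtype_coe measurable_subtype_coe, integral_map]
      · rfl
      · exact (measurable_subtype_coe.prodMap measurable_subtype_coe).aemeasurable
      · exact (continuous_truncLogKernel M).aestronglyMeasurable
    have h3 : ∀ N, ∫ p, f p ∂((μ N : Measure K).prod (μ N)) ≤ M / m N + b := by
      intro N
      have hmN : (0 : ℝ) < m N := by exact_mod_cast Nat.pos_of_ne_zero (hm0 N)
      have hint : Integrable f ((μ N : Measure K).prod (μ N)) :=
        (BoundedContinuousFunction.mkOfCompact f).integrable _
      rw [integral_prod _ hint]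
      have h4 := sum_truncLogKernel_le M (hv N)
      change ∫ x, ∫ y, f (x, y) ∂(empiricalMeasure (w N)) ∂(empiricalMeasure (w N)) ≤ _
      simp_rw [integral_empiricalMeasure]
      rw [← Finset.mul_sum]
      change (m N : ℝ)⁻¹ * ((m N : ℝ)⁻¹ * ∑ i, ∑ j, truncLogKernel M (v N i, v N j)) ≤ _
      calc _ ≤ (m N : ℝ)⁻¹ * ((m N : ℝ)⁻¹ * (m N * M + 2 * (b / 2 * m N ^ 2))) := by gcongr
        _ = M / m N + b := by field_simp
    rw [h2]
    have hmt : Filter.Tendsto (fun N => (M : ℝ) / m N + b) (Filter.hyperfilter ℕ)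
        (nhds (0 + b)) := by
      refine Filter.Tendsto.add_const b (Filter.Tendsto.mono_left ?_ Nat.hyperfilter_le_atTop)
      refine Filter.Tendsto.div_atTop tendsto_const_nhds ?_
      refine tendsto_natCast_atTop_atTop.comp (Filter.tendsto_atTop_mono (fun N => ?_)
        Filter.tendsto_id)
      exact (Nat.le_succ N).trans (hm N)
    rw [zero_add] at hmt
    exact le_of_tendsto_of_tendsto' h1 hmt h3
  have h5 := logEnergy_le_of_forall_truncLogKernel hK hν'K hkey
  have h6 : robinConstant K ≤ logEnergy ν' := iInf_le_of_le ν' (iInf₂_le hν'p hν'K)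
  exact absurd (h6.trans h5) hb.not_ge

/-- The Hilbert–Fekete theorem for real sets. -/
theorem exists_int_polynomial_abs_lt_one {E : Set ℝ} (hE : IsCompact E) (hinf : E.Infinite)
    (hcap : logCapacity (Complex.ofReal '' E) < 1) :
    ∃ P : ℤ[X], P ≠ 0 ∧ ∀ x ∈ E, |aeval x P| < 1 := by
  have hpos : 0 < robinConstant (Complex.ofReal '' E) := by
    rw [logCapacity, EReal.exp_lt_one_iff] at hcap
    simpa using EReal.neg_lt_neg_iff.2 hcap
  obtain ⟨c, hc, N, hN⟩ := exists_prod_norm_sub_le_of_robinConstant_pos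
    (hE.image Complex.continuous_ofReal) hpos
  -- Halving `c` makes the determinant inequality strict. The factor `n` is the loss from summing
  -- over the Fekete points.
  obtain ⟨n, hnN, hn0, hn⟩ : ∃ n : ℕ, N ≤ n ∧ 0 < n ∧ n * Real.exp (-(c / 2 * n)) < 1 := by
    have h1 : Filter.Tendsto (fun n : ℕ => (n : ℝ) * Real.exp (-(c / 2 * n))) Filter.atTop
        (nhds 0) := by
      have := (Real.tendsto_pow_mul_exp_neg_atTop_nhds_zero 1).comp
        ((tendsto_natCast_atTop_atTop (R := ℝ)).const_mul_atTop (half_pos hc))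
      have h2 := this.const_mul (c / 2)⁻¹
      rw [mul_zero] at h2
      refine h2.congr fun n => ?_
      simp only [Function.comp_apply, pow_one]
      field_simp
    obtain ⟨n, hn⟩ := ((h1.eventually_lt_const one_pos).and
      ((Filter.eventually_ge_atTop N).and (Filter.eventually_gt_atTop 0))).exists
    exact ⟨n, hn.2.1, hn.2.2, hn.1⟩
  obtain ⟨v, hv, hvE, hP⟩ := exists_fekete_points hE hinf n
  have hdet : |(Matrix.vandermonde v).det| < ∏ _i : Fin n, Real.exp (-(c / 2 * n)) := by
    have h1 := hN n hnN (fun i => (v i : ℂ)) fun i => ⟨v i, hvE i, rfl⟩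
    simp_rw [← Complex.ofReal_sub, Complex.norm_real, Real.norm_eq_abs] at h1
    simp_rw [Matrix.det_vandermonde, Finset.abs_prod]
    refine h1.trans_lt ?_
    rw [Finset.prod_const, Finset.card_univ, Fintype.card_fin, ← Real.exp_nat_mul]
    refine Real.exp_lt_exp.2 ?_
    have : (0 : ℝ) < n := by exact_mod_cast hn0
    nlinarith [mul_pos hc (mul_pos this this)]
  obtain ⟨P, hP0, hPd, hPv⟩ := exists_int_polynomial_lt_of_det_vandermonde hv
    (fun _ => Real.exp_pos _) hdet
  refine ⟨P, hP0, fun x hx => (hP P hPd x hx).trans_lt (lt_of_le_of_lt ?_ hn)⟩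
  refine (Finset.sum_le_sum fun i _ => (hPv i).le).trans ?_
  simp

/-! ### Finiteness of level sets of products of powers. -/

/-- The numerator of the logarithmic derivative of `∏ i, f i ^ α i`. -/
noncomputable def weightedDerivNumerator {ι : Type*} [Fintype ι] [DecidableEq ι] (f : ι → ℝ[X])
    (α : ι → ℝ) : ℝ[X] :=
  ∑ i, C (α i) * (derivative (f i) * ∏ j ∈ Finset.univ.erase i, f j)

/-- The coefficient in degree `∑ deg f i - 1` is `∑ α i * deg f i` times the leading coefficients;
nonnegative weights exclude cancellation. -/
theorem weightedDerivNumerator_ne_zero {ι : Type*} [Fintype ι] [DecidableEq ι] {f : ι → ℝ[X]}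
    (hf : ∀ i, 0 < (f i).natDegree) {α : ι → ℝ} (hα : ∀ i, 0 ≤ α i) (h : ∃ i, α i ≠ 0) :
    weightedDerivNumerator f α ≠ 0 := by
  have hf0 : ∀ i, f i ≠ 0 := fun i => ne_zero_of_natDegree_gt (hf i)
  have hcoeff : (weightedDerivNumerator f α).coeff (∑ i, (f i).natDegree - 1) =
      (∑ i, α i * (f i).natDegree) * ∏ i, (f i).leadingCoeff := by
    rw [weightedDerivNumerator, finsetSum_coeff, Finset.sum_mul]
    refine Finset.sum_congr rfl fun i _ => ?_
    have hi := hf i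
    have hdeg : ∑ j, (f j).natDegree - 1 =
        ((f i).natDegree - 1) + ∑ j ∈ Finset.univ.erase i, (f j).natDegree := by
      rw [← Finset.add_sum_erase _ _ (Finset.mem_univ i)]
      omega
    have hprod : (∏ j ∈ Finset.univ.erase i, f j).natDegree =
        ∑ j ∈ Finset.univ.erase i, (f j).natDegree := natDegree_prod _ _ fun j _ => hf0 j
    rw [coeff_C_mul, hdeg, coeff_mul_add_eq_of_natDegree_le (natDegree_derivative_le _) hprod.le,
      ← hprod, coeff_natDegree, leadingCoeff_prod, coeff_derivative,
      ← Finset.mul_prod_erase _ _ (Finset.mem_univ i), Nat.sub_add_cancel hi, leadingCoeff]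
    have : (((f i).natDegree - 1 : ℕ) : ℝ) + 1 = (f i).natDegree := by
      rw [Nat.cast_sub hi]; simp
    rw [this]
    ring
  obtain ⟨i, hi⟩ := h
  intro h0
  rw [h0, coeff_zero] at hcoeff
  refine mul_ne_zero (ne_of_gt ?_)
    (Finset.prod_ne_zero_iff.2 fun i _ => leadingCoeff_ne_zero.2 (hf0 i)) hcoeff.symm
  refine Finset.sum_pos' (fun j _ => mul_nonneg (hα j) (Nat.cast_nonneg _)) ⟨i, Finset.mem_univ i, ?_⟩
  exact mul_pos ((hα i).lt_of_ne' hi) (Nat.cast_pos.2 (hf i))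

/-- A set of reals is finite if between any two of its points there is a point of a fixed finite
set. -/
theorem Set.Finite.of_forall_exists_between {S : Set ℝ} (R : Finset ℝ)
    (h : ∀ a ∈ S, ∀ b ∈ S, a < b → ∃ r ∈ R, a ≤ r ∧ r < b) : S.Finite := by
  have hlt : ∀ a ∈ S, ∀ b ∈ S, a < b → (R.filter (· < a)).card < (R.filter (· < b)).card := by
    intro a ha b hb hab
    obtain ⟨r, hr, har, hrb⟩ := h a ha b hb hab
    refine Finset.card_lt_card ⟨fun x hx => ?_, fun hsub => ?_⟩
    · rw [Finset.mem_filter] at hx ⊢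
      exact ⟨hx.1, hx.2.trans hab⟩
    · exact har.not_gt (Finset.mem_filter.1 (hsub (Finset.mem_filter.2 ⟨hr, hrb⟩))).2
  refine Set.Finite.of_finite_image (f := fun a => (R.filter (· < a)).card)
    ((Set.finite_Iic R.card).subset ?_) ?_
  · rintro _ ⟨a, -, rfl⟩
    exact Finset.card_filter_le _ _
  · intro a ha b hb hab
    rcases lt_trichotomy a b with h' | h' | h'
    · exact absurd hab (hlt a ha b hb h').ne
    · exact h'
    · exact absurd hab (hlt b hb a ha h').ne'

/-- By Rolle, two solutions are separated by a zero of some `f i` or of the numerator of the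
derivative. -/
theorem finite_setOf_sum_mul_log_eval_eq {ι : Type*} [Fintype ι] {f : ι → ℝ[X]}
    (hf : ∀ i, 0 < (f i).natDegree) {α : ι → ℝ} (hα : ∀ i, 0 ≤ α i) (h : ∃ i, α i ≠ 0) (u : ℝ) :
    {x : ℝ | (∀ i, (f i).eval x ≠ 0) ∧ ∑ i, α i * Real.log ((f i).eval x) = u}.Finite := by
  classical
  have hf0 : ∀ i, f i ≠ 0 := fun i => ne_zero_of_natDegree_gt (hf i)
  set D := weightedDerivNumerator f α
  have hG : D * ∏ i, f i ≠ 0 := mul_ne_zero (weightedDerivNumerator_ne_zero hf hα h)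
    (Finset.prod_ne_zero_iff.2 fun i _ => hf0 i)
  refine Set.Finite.of_forall_exists_between (D * ∏ i, f i).roots.toFinset ?_
  rintro a ⟨-, ha⟩ b ⟨hb0, hb⟩ hab
  simp only [Multiset.mem_toFinset, mem_roots hG, IsRoot.def, eval_mul, mul_eq_zero, eval_prod]
  by_contra! hcon
  have hne : ∀ x ∈ Set.Icc a b, ∀ i, (f i).eval x ≠ 0 := by
    intro x hx i
    rcases hx.2.eq_or_lt with rfl | hlt
    · exact hb0 i
    · intro h0
      exact (hcon x (Or.inr (Finset.prod_eq_zero (Finset.mem_univ i) h0)) hx.1).not_gt hlt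
  have hderiv : ∀ x ∈ Set.Icc a b, HasDerivAt
      (fun x => ∑ i, α i * Real.log ((f i).eval x))
      (∑ i, α i * ((derivative (f i)).eval x / (f i).eval x)) x := by
    intro x hx
    exact HasDerivAt.fun_sum fun i _ => (((f i).hasDerivAt x).log (hne x hx i)).const_mul (α i)
  obtain ⟨x, hx, hx0⟩ := exists_hasDerivAt_eq_zero hab
    (fun x hx => (hderiv x hx).continuousAt.continuousWithinAt) (ha.trans hb.symm)
    fun x hx => hderiv x (Set.Ioo_subset_Icc_self hx)
  have hx' := Set.Ioo_subset_Icc_self hx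
  refine (hcon x (Or.inl ?_) hx.1.le).not_gt hx.2
  have : D.eval x = (∑ i, α i * ((derivative (f i)).eval x / (f i).eval x)) *
      ∏ i, (f i).eval x := by
    simp only [D, weightedDerivNumerator, eval_finsetSum, Finset.sum_mul, eval_mul, eval_C,
      eval_prod]
    refine Finset.sum_congr rfl fun i _ => ?_
    rw [← Finset.mul_prod_erase _ _ (Finset.mem_univ i)]
    field_simp [hne x hx' i]
  rw [this, hx0, zero_mul]

theorem finite_setOf_prod_rpow_eq {ι : Type*} [Fintype ι] {F : ι → ℤ[X]}
    (hF : ∀ i, 0 < (F i).natDegree) {α : ι → ℝ} (hα : ∀ i, 0 ≤ α i) {t : ℝ} (ht : t ≠ 1) :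
    {x : ℝ | (∀ i, aeval x (F i) ≠ 0) ∧ ∏ i, |aeval x (F i)| ^ α i = t}.Finite := by
  by_cases h : ∃ i, α i ≠ 0
  · refine (finite_setOf_sum_mul_log_eval_eq (f := fun i => (F i).map (algebraMap ℤ ℝ))
      (fun i => ?_) hα h (Real.log t)).subset ?_
    · rw [natDegree_map_eq_of_injective (algebraMap ℤ ℝ).injective_int]
      exact hF i
    · rintro x ⟨hx0, hx⟩
      simp only [Set.mem_ofPred_eq, eval_map_algebraMap]
      refine ⟨hx0, ?_⟩
      rw [← hx, Real.log_prod fun i _ => (Real.rpow_pos_of_pos (abs_pos.2 (hx0 i)) _).ne']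
      refine Finset.sum_congr rfl fun i _ => ?_
      rw [Real.log_rpow (abs_pos.2 (hx0 i)), Real.log_abs]
  · push Not at h
    convert Set.finite_empty
    ext x
    simp [h, ht.symm]

/-! ### Real exponents and the perturbation argument. -/

/-- If exponents exist for every bound larger than `t`, then they exist for the bound `t`. -/
theorem exists_exponents_of_forall_gt {ι : Type*} [Fintype ι] {F : ι → ℤ[X]}
    (hF : ∀ i, 0 < (F i).natDegree) {E : Set ℝ} {t : ℝ}
    (h : ∀ τ > t, ∃ α : ι → ℝ, (∀ i, 0 ≤ α i) ∧ ∑ i, α i * (F i).natDegree ≤ 1 ∧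
      ∀ x ∈ E, (∀ i, aeval x (F i) ≠ 0) → ∏ i, |aeval x (F i)| ^ α i ≤ τ) :
    ∃ α : ι → ℝ, (∀ i, 0 ≤ α i) ∧ ∑ i, α i * (F i).natDegree ≤ 1 ∧
      ∀ x ∈ E, (∀ i, aeval x (F i) ≠ 0) → ∏ i, |aeval x (F i)| ^ α i ≤ t := by
  choose α h0 h1 hα using fun k : ℕ => h (t + 1 / ((k : ℝ) + 1))
    (lt_add_of_pos_right _ Nat.one_div_pos_of_nat)
  have hmem : ∀ k, α k ∈ Set.univ.pi fun _ : ι => Set.Icc (0 : ℝ) 1 := by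
    intro k i _
    refine ⟨h0 k i, le_trans ?_ (h1 k)⟩
    refine le_trans ?_ (Finset.single_le_sum
      (fun j _ => mul_nonneg (h0 k j) (Nat.cast_nonneg _)) (Finset.mem_univ i))
    exact le_mul_of_one_le_right (h0 k i) (by exact_mod_cast hF i)
  obtain ⟨a, -, φ, hφ, ha⟩ := (isCompact_univ_pi fun _ : ι => isCompact_Icc).tendsto_subseq hmem
  have hai : ∀ i, Filter.Tendsto (fun k => α (φ k) i) Filter.atTop (nhds (a i)) :=
    fun i => (tendsto_pi_nhds.1 ha) i
  refine ⟨a, fun i => ge_of_tendsto' (hai i) fun k => h0 _ i, ?_, fun x hx hx0 => ?_⟩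
  · exact le_of_tendsto' (tendsto_finsetSum _ fun i _ => (hai i).mul_const _) fun k => h1 _
  · have hr : Filter.Tendsto (fun k => t + 1 / ((φ k : ℝ) + 1)) Filter.atTop (nhds (t + 0)) :=
      (tendsto_one_div_add_atTop_nhds_zero_nat.comp hφ.tendsto_atTop).const_add t
    rw [add_zero] at hr
    refine le_of_tendsto_of_tendsto' (tendsto_finsetProd _ fun i _ => ?_) hr
      fun k => hα (φ k) x hx hx0
    exact (tendsto_const_nhds (x := |aeval x (F i)|)).rpow (hai i)
      (Or.inl (abs_pos.2 (hx0 i)).ne')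

theorem continuous_aeval_int (P : ℤ[X]) : Continuous fun x : ℝ => aeval x P := by
  simp_rw [← eval_map_algebraMap]
  exact Polynomial.continuous _

/-- A lower bound for the sup norms of integer polynomials carries over to products of real
powers of integer polynomials. -/
theorem exists_le_prod_rpow {ι : Type*} [Fintype ι] {E : Set ℝ} (hE : IsCompact E) {t : ℝ}
    (ht : 0 ≤ t)
    (hlow : ∀ N : ℕ, 1 ≤ N → ∀ P : ℤ[X], P ≠ 0 → P.natDegree ≤ N → ∃ x ∈ E, t ^ N ≤ |aeval x P|)
    {F : ι → ℤ[X]} (hF : ∀ i, F i ≠ 0) {β : ι → ℝ} (hβ : ∀ i, 0 < β i)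
    (hsum : ∑ i, β i * (F i).natDegree ≤ 1) :
    ∃ x ∈ E, t ≤ ∏ i, |aeval x (F i)| ^ β i := by
  set e : ℕ → ι → ℕ := fun N i => ⌊β i * N⌋₊ with he
  have hx : ∀ N : ℕ, ∃ x ∈ E, t ^ (N + 1) ≤ |aeval x (∏ i, F i ^ e (N + 1) i)| := by
    intro N
    refine hlow (N + 1) (by omega) _ (Finset.prod_ne_zero_iff.2 fun i _ => pow_ne_zero _ (hF i)) ?_
    rw [natDegree_prod _ _ fun i _ => pow_ne_zero _ (hF i)]
    simp_rw [natDegree_pow]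
    rw [← Nat.cast_le (α := ℝ)]
    push_cast
    calc ∑ i, (e (N + 1) i : ℝ) * (F i).natDegree
        ≤ ∑ i, (β i * (N + 1 : ℕ)) * (F i).natDegree := by
          refine Finset.sum_le_sum fun i _ => mul_le_mul_of_nonneg_right ?_ (Nat.cast_nonneg _)
          exact Nat.floor_le (mul_nonneg (hβ i).le (Nat.cast_nonneg _))
      _ = (∑ i, β i * (F i).natDegree) * (N + 1 : ℕ) := by
          rw [Finset.sum_mul]; exact Finset.sum_congr rfl fun i _ => by ring
      _ ≤ 1 * (N + 1 : ℕ) := mul_le_mul_of_nonneg_right hsum (Nat.cast_nonneg _)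
      _ = N + 1 := by push_cast; ring
  choose x hxE hx using hx
  obtain ⟨y, hy, φ, hφ, hlim⟩ := hE.tendsto_subseq hxE
  refine ⟨y, hy, ?_⟩
  have hbase : ∀ N : ℕ, t ≤ ∏ i, |aeval (x N) (F i)| ^ ((e (N + 1) i : ℝ) / (N + 1 : ℕ)) := by
    intro N
    have h1 := hx N
    rw [map_prod, Finset.abs_prod] at h1
    have h2 := Real.rpow_le_rpow (by positivity) h1
      (by positivity : (0 : ℝ) ≤ ((N + 1 : ℕ) : ℝ)⁻¹)
    rw [Real.pow_rpow_inv_natCast ht (by omega),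
      ← Real.finsetProd_rpow _ _ fun i _ => abs_nonneg _] at h2
    refine h2.trans_eq (Finset.prod_congr rfl fun i _ => ?_)
    rw [map_pow, abs_pow, ← Real.rpow_natCast, ← Real.rpow_mul (abs_nonneg _), div_eq_mul_inv]
  refine ge_of_tendsto' (x := Filter.atTop) (tendsto_finsetProd _ fun i _ => ?_)
    fun k => hbase (φ k)
  -- The base may tend to 0, so continuity of the power needs a positive exponent.
  refine Filter.Tendsto.rpow ?_ ?_ (Or.inr (hβ i))
  · exact (((continuous_aeval_int (F i)).tendsto y).comp hlim).abs
  · have h3 : Filter.Tendsto (fun N : ℕ => (e N i : ℝ) / N) Filter.atTop (nhds (β i)) :=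
      (tendsto_nat_floor_mul_div_atTop (hβ i).le).comp tendsto_natCast_atTop_atTop
    exact h3.comp ((Filter.tendsto_add_atTop_nat 1).comp hφ.tendsto_atTop)

theorem not_forall_prod_rpow_le {ι : Type*} [Fintype ι] {E : Set ℝ} (hE : IsCompact E) {t : ℝ}
    (ht0 : 0 < t) (ht1 : t < 1)
    (hlow : ∀ N : ℕ, 1 ≤ N → ∀ P : ℤ[X], P ≠ 0 → P.natDegree ≤ N → ∃ x ∈ E, t ^ N ≤ |aeval x P|)
    {F : ι → ℤ[X]} (hF : ∀ i, 0 < (F i).natDegree) {α : ι → ℝ} (hα : ∀ i, 0 ≤ α i)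
    (hsum : ∑ i, α i * (F i).natDegree ≤ 1) :
    ¬ ∀ x ∈ E, (∀ i, aeval x (F i) ≠ 0) → ∏ i, |aeval x (F i)| ^ α i ≤ t := by
  intro hle
  have hF0 : ∀ i, F i ≠ 0 := fun i => ne_zero_of_natDegree_gt (hF i)
  set g : ℝ → ℝ := fun x => ∏ i, |aeval x (F i)| ^ α i with hg
  have hgc : Continuous g := continuous_finsetProd _ fun i _ =>
    (continuous_aeval_int (F i)).abs.rpow_const fun _ => Or.inr (hα i)
  have hg0 : ∀ x, 0 ≤ g x := fun x => Finset.prod_nonneg fun i _ => by positivity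
  have hSfin := finite_setOf_prod_rpow_eq hF hα ht1.ne
  -- A positive bound for the degree of `P * ∏ F i`, fixed before `P` because the required smallness
  -- `τ` depends on it.
  set D : ℕ := hSfin.toFinset.card + ∑ i, (F i).natDegree + 1
  have hDpos : (0 : ℝ) < D := by positivity
  have hprodc : Continuous fun x : ℝ => ∏ i, |aeval x (F i)| :=
    continuous_finsetProd _ fun i _ => (continuous_aeval_int (F i)).abs
  obtain ⟨B, hB⟩ := hE.exists_bound_of_continuousOn hprodc.continuousOn
  obtain ⟨P, hP0, hPd, hP⟩ := exists_int_polynomial_lt_on_finset hSfin.toFinset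
    (τ := t ^ D / (|B| + 1)) (by positivity)
  -- Including the `F i` makes `h` vanish at their zeros, where `g` is not controlled, and makes all
  -- exponents below positive even if `α i = 0`.
  set h : ℝ → ℝ := fun x => (|aeval x P| * ∏ i, |aeval x (F i)|) ^ (D : ℝ)⁻¹ with hh
  have hhc : Continuous h := ((continuous_aeval_int P).abs.mul hprodc).rpow_const
    fun _ => Or.inr (by positivity)
  have hh0 : ∀ x, 0 ≤ h x := fun x => by positivity
  have hroot : ∀ x, ∀ i, aeval x (F i) = 0 → h x = 0 := by
    intro x i hi
    rw [hh]
    simp only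
    rw [Finset.prod_eq_zero (Finset.mem_univ i) (by rw [hi, abs_zero]), mul_zero,
      Real.zero_rpow (inv_pos.2 hDpos).ne']
  have hS : ∀ x ∈ E, (∀ i, aeval x (F i) ≠ 0) → g x = t → h x < t := by
    intro x hx hx0 hgx
    have h1 := hP x (hSfin.mem_toFinset.2 ⟨hx0, hgx⟩)
    have h2 : ∏ i, |aeval x (F i)| < |B| + 1 :=
      ((le_abs_self _).trans (hB x hx)).trans_lt ((le_abs_self B).trans_lt (lt_add_one _))
    have h3 : 0 < ∏ i, |aeval x (F i)| := Finset.prod_pos fun i _ => abs_pos.2 (hx0 i)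
    have h4 : |aeval x P| * ∏ i, |aeval x (F i)| < t ^ D := by
      rw [lt_div_iff₀ (by positivity)] at h1
      exact lt_of_le_of_lt (mul_le_mul_of_nonneg_left h2.le (abs_nonneg _)) h1
    have h5 := Real.rpow_lt_rpow (by positivity) h4 (inv_pos.2 hDpos)
    rwa [Real.pow_rpow_inv_natCast ht0.le (by omega)] at h5
  set ε : ℕ → ℝ := fun k => 1 / ((k : ℝ) + 1) with hεdef
  have hε0 : ∀ k, 0 < ε k := fun k => Nat.one_div_pos_of_nat
  have hε1 : ∀ k, ε k ≤ 1 := fun k => by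
    rw [hεdef]; simp only; rw [div_le_one (by positivity)]; linarith [Nat.cast_nonneg (α := ℝ) k]
  have hex : ∀ k, ∃ x ∈ E, t ≤ h x ^ ε k * g x ^ (1 - ε k) := by
    intro k
    set ε' := ε k
    have hε0' : 0 < ε' := hε0 k
    have hε1' : 0 ≤ 1 - ε' := sub_nonneg.2 (hε1 k)
    let G : Option ι → ℤ[X] := fun o => o.elim P F
    let β : Option ι → ℝ := fun o => o.elim ((D : ℝ)⁻¹ * ε') fun i => (D : ℝ)⁻¹ * ε' + α i * (1 - ε')
    obtain ⟨x, hx, hxt⟩ := exists_le_prod_rpow hE ht0.le hlow (F := G) (β := β)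
      (Option.rec hP0 hF0)
      (Option.rec (by positivity : 0 < (D : ℝ)⁻¹ * ε') fun i => add_pos_of_pos_of_nonneg
        (by positivity) (mul_nonneg (hα i) hε1')) (by
        simp only [Fintype.sum_option, G, β, Option.elim]
        have h1 : ((P.natDegree + ∑ i, (F i).natDegree : ℕ) : ℝ) ≤ D := by
          exact_mod_cast (by omega : P.natDegree + ∑ i, (F i).natDegree ≤ D)
        push_cast at h1
        calc _ = (D : ℝ)⁻¹ * ε' * (P.natDegree + ∑ i, ((F i).natDegree : ℝ)) +
              (1 - ε') * ∑ i, α i * (F i).natDegree := by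
              rw [mul_add, Finset.mul_sum, Finset.mul_sum, add_assoc, ← Finset.sum_add_distrib]
              congr 1
              exact Finset.sum_congr rfl fun i _ => by ring
          _ ≤ (D : ℝ)⁻¹ * ε' * D + (1 - ε') * 1 := by gcongr
          _ = 1 := by field_simp; ring)
    refine ⟨x, hx, hxt.trans_eq ?_⟩
    simp only [Fintype.prod_option, G, β, Option.elim, hh, hg]
    rw [← Real.rpow_mul (by positivity), Real.mul_rpow (by positivity) (by positivity),
      ← Real.finsetProd_rpow _ _ fun i _ => abs_nonneg _,
      ← Real.finsetProd_rpow _ _ fun i _ => by positivity, mul_assoc, ← Finset.prod_mul_distrib]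
    congr 1
    refine Finset.prod_congr rfl fun i _ => ?_
    rw [Real.rpow_add_of_nonneg (abs_nonneg _) (by positivity) (mul_nonneg (hα i) hε1'),
      Real.rpow_mul (abs_nonneg _) (α i)]
  choose x hxE hx using hex
  have hxr : ∀ k i, aeval (x k) (F i) ≠ 0 := by
    intro k i hi
    have := hx k
    rw [hroot _ i hi, Real.zero_rpow (hε0 k).ne', zero_mul] at this
    exact ht0.not_ge this
  have hht : ∀ k, t ≤ h (x k) := by
    intro k
    have h1 : t ^ ε k * t ^ (1 - ε k) ≤ h (x k) ^ ε k * t ^ (1 - ε k) := by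
      rw [← Real.rpow_add ht0, add_sub_cancel, Real.rpow_one]
      refine (hx k).trans (mul_le_mul_of_nonneg_left ?_ (Real.rpow_nonneg (hh0 _) _))
      exact Real.rpow_le_rpow (hg0 _) (hle _ (hxE k) (hxr k)) (sub_nonneg.2 (hε1 k))
    exact (Real.rpow_le_rpow_iff ht0.le (hh0 _) (hε0 k)).1
      (le_of_mul_le_mul_right h1 (Real.rpow_pos_of_pos ht0 _))
  obtain ⟨y, hy, φ, hφ, hlim⟩ := hE.tendsto_subseq hxE
  have hyh : t ≤ h y := ge_of_tendsto' ((hhc.tendsto y).comp hlim) fun k => hht (φ k)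
  have hyr : ∀ i, aeval y (F i) ≠ 0 := fun i hi =>
    ht0.not_ge (hyh.trans_eq (hroot y i hi))
  have hεlim : Filter.Tendsto (fun k => ε (φ k)) Filter.atTop (nhds 0) :=
    tendsto_one_div_add_atTop_nhds_zero_nat.comp hφ.tendsto_atTop
  have hgy : t ≤ g y := by
    have h1 : Filter.Tendsto
        (fun k => h (x (φ k)) ^ ε (φ k) * g (x (φ k)) ^ (1 - ε (φ k))) Filter.atTop
        (nhds (h y ^ (0 : ℝ) * g y ^ (1 - (0 : ℝ)))) := by
      refine (((hhc.tendsto y).comp hlim).rpow hεlim (Or.inl (ht0.trans_le hyh).ne')).mul ?_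
      exact ((hgc.tendsto y).comp hlim).rpow (tendsto_const_nhds.sub hεlim) (Or.inr (by norm_num))
    rw [Real.rpow_zero, sub_zero, Real.rpow_one, one_mul] at h1
    exact ge_of_tendsto' h1 fun k => hx (φ k)
  exact hyh.not_gt (hS y hy hyr (le_antisymm (hle y hy hyr) hgy))

/-! ### Factorisation, norms and the conclusion. -/

/-- A nonzero integer polynomial is an integer times a product of powers of its non-constant
irreducible factors. -/
theorem exists_eq_C_mul_prod_pow (𝓕 : Finset ℤ[X]) {Q : ℤ[X]} (hQ : Q ≠ 0)
    (h : ∀ F : ℤ[X], Irreducible F → 0 < F.natDegree → F ∣ Q → F ∈ 𝓕) :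
    ∃ (c : ℤ) (m : 𝓕 → ℕ), c ≠ 0 ∧ Q = C c * ∏ F : 𝓕, (F : ℤ[X]) ^ m F := by
  classical
  induction Q using WfDvdMonoid.induction_on_irreducible with
  | zero => exact absurd rfl hQ
  | unit u hu =>
    obtain ⟨r, hr, rfl⟩ := Polynomial.isUnit_iff.1 hu
    exact ⟨r, 0, hr.ne_zero, by simp⟩
  | mul a i ha hi ih =>
    obtain ⟨c, m, hc, hm⟩ := ih ha fun F hF hd hFa => h F hF hd (hFa.mul_left i)
    -- Constant irreducibles, the primes of ℤ, are absorbed into `c`.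
    rcases Nat.eq_zero_or_pos i.natDegree with h0 | hpos
    · obtain ⟨r, rfl⟩ := natDegree_eq_zero.1 h0
      refine ⟨r * c, m, mul_ne_zero ?_ hc, ?_⟩
      · rintro rfl
        simp at hi
      · rw [hm, C_mul, mul_assoc]
    · refine ⟨c, m + Pi.single ⟨i, h i hi hpos (dvd_mul_right i a)⟩ 1, hc, ?_⟩
      simp only [Pi.add_apply, pow_add, Finset.prod_mul_distrib]
      rw [Finset.prod_eq_single_of_mem (s := Finset.univ)
        (f := fun F : 𝓕 => (F : ℤ[X]) ^ (Pi.single (M := fun _ => ℕ) _ 1 F)) _ (Finset.mem_univ _)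
        fun F _ hF => by rw [Pi.single_eq_of_ne hF, pow_zero]]
      rw [Pi.single_eq_same, pow_one]
      conv_lhs => rw [hm]
      ring

theorem norm_aeval_ofReal (x : ℝ) (P : ℤ[X]) : ‖aeval (x : ℂ) P‖ = |aeval x P| := by
  rw [← Complex.coe_algebraMap, aeval_algebraMap_apply, Complex.coe_algebraMap,
    Complex.norm_real, Real.norm_eq_abs]

theorem polySupNorm_ofReal (E : Set ℝ) (P : ℤ[X]) :
    polySupNorm (Complex.ofReal '' E) P = sSup ((fun x : ℝ => |aeval x P|) '' E) := by
  simp_rw [polySupNorm, Set.image_image, norm_aeval_ofReal]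

theorem abs_aeval_le_polySupNorm {E : Set ℝ} (hE : IsCompact E) (P : ℤ[X]) {x : ℝ} (hx : x ∈ E) :
    |aeval x P| ≤ polySupNorm (Complex.ofReal '' E) P := by
  rw [polySupNorm_ofReal]
  exact le_csSup (hE.bddAbove_image (continuous_aeval_int P).abs.continuousOn) ⟨x, hx, rfl⟩

theorem exists_abs_aeval_eq_polySupNorm {E : Set ℝ} (hE : IsCompact E) (hne : E.Nonempty)
    (P : ℤ[X]) : ∃ x ∈ E, |aeval x P| = polySupNorm (Complex.ofReal '' E) P := by
  rw [polySupNorm_ofReal]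
  obtain ⟨x, hx, h⟩ := hE.exists_sSup_image_eq hne (continuous_aeval_int P).abs.continuousOn
  exact ⟨x, hx, h.symm⟩

theorem exists_aeval_ne_zero_of_infinite {ι : Type*} [Fintype ι] {E : Set ℝ} (hinf : E.Infinite)
    {F : ι → ℤ[X]} (hF : ∀ i, F i ≠ 0) : ∃ x ∈ E, ∀ i, aeval x (F i) ≠ 0 := by
  have hG : ∏ i, F i ≠ 0 := Finset.prod_ne_zero_iff.2 fun i _ => hF i
  obtain ⟨x, hx, hx'⟩ := (hinf.sdiff (rootSet_finite (∏ i, F i) ℝ)).nonempty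
  refine ⟨x, hx, fun i hi => hx' (mem_rootSet.2 ⟨hG, ?_⟩)⟩
  rw [map_prod, Finset.prod_eq_zero (Finset.mem_univ i) hi]

theorem theorem1p5 (E : Set ℝ) (hE : IsCompact E) (hinf : E.Infinite)
    (hcap : logCapacity (Complex.ofReal '' E) < 1)
    (Q : ℕ → ℤ[X]) (hQ : ∀ n, 1 ≤ n → IsIntegerChebyshev (Complex.ofReal '' E) n (Q n)) :
    {F : ℤ[X] | Irreducible F ∧ 0 < F.natDegree ∧ ∃ n, 1 ≤ n ∧ F ∣ Q n}.Infinite := by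
  intro hfin
  have hne := hinf.nonempty
  set 𝓕 : Finset ℤ[X] := hfin.toFinset
  set F : 𝓕 → ℤ[X] := Subtype.val
  have hFd : ∀ i, 0 < (F i).natDegree := fun i => (hfin.mem_toFinset.1 i.2).2.1
  have hF0 : ∀ i, F i ≠ 0 := fun i => ne_zero_of_natDegree_gt (hFd i)
  set s : ℕ → ℝ := fun n => polySupNorm (Complex.ofReal '' E) (Q n)
  have hs0 : ∀ n, 0 ≤ s n := fun n => by
    obtain ⟨x, hx, hxs⟩ := exists_abs_aeval_eq_polySupNorm hE hne (Q n)
    exact (abs_nonneg _).trans_eq hxs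
  set u : ℕ → ℝ := fun n => s (n + 1) ^ ((n + 1 : ℕ) : ℝ)⁻¹ with hu
  have hu0 : ∀ n, 0 ≤ u n := fun n => Real.rpow_nonneg (hs0 _) _
  have hubdd : BddBelow (Set.range u) := ⟨0, by rintro _ ⟨n, rfl⟩; exact hu0 n⟩
  set t : ℝ := ⨅ n, u n
  have ht0 : 0 ≤ t := Real.iInf_nonneg hu0
  have hu_pow : ∀ n, u n ^ (n + 1) = s (n + 1) := fun n =>
    Real.rpow_inv_natCast_pow (hs0 _) (by omega)
  have hlow : ∀ N : ℕ, 1 ≤ N → ∀ P : ℤ[X], P ≠ 0 → P.natDegree ≤ N →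
      ∃ x ∈ E, t ^ N ≤ |aeval x P| := by
    intro N hN P hP hPd
    obtain ⟨n, rfl⟩ := Nat.exists_eq_add_of_le' hN
    obtain ⟨x, hx, hxs⟩ := exists_abs_aeval_eq_polySupNorm hE hne P
    refine ⟨x, hx, ?_⟩
    rw [hxs]
    refine le_trans ?_ ((hQ (n + 1) hN).2.2 P hP hPd)
    exact (pow_le_pow_left₀ ht0 (ciInf_le hubdd n) _).trans_eq (hu_pow n)
  obtain ⟨α, hα, hαsum, hαE⟩ := exists_exponents_of_forall_gt hFd (E := E) (t := t) (by
    intro τ hτ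
    obtain ⟨n, hn⟩ := exists_lt_of_ciInf_lt hτ
    have hchev := hQ (n + 1) (by omega)
    obtain ⟨c, m, hc, hm⟩ := exists_eq_C_mul_prod_pow 𝓕 hchev.1 fun G hG hGd hGQ =>
      hfin.mem_toFinset.2 ⟨hG, hGd, n + 1, by omega, hGQ⟩
    refine ⟨fun i => m i * ((n + 1 : ℕ) : ℝ)⁻¹, fun i => by positivity, ?_, fun x hx _ => ?_⟩
    · have hdeg := hchev.2.1
      rw [hm, natDegree_C_mul hc, natDegree_prod _ _ fun i _ => pow_ne_zero _ (hF0 i)] at hdeg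
      simp_rw [natDegree_pow] at hdeg
      calc _ = (∑ i, (m i : ℝ) * (F i).natDegree) / (n + 1 : ℕ) := by
            rw [div_eq_mul_inv, Finset.sum_mul]
            exact Finset.sum_congr rfl fun i _ => by ring
        _ ≤ 1 := by
            rw [div_le_one (by positivity)]
            exact_mod_cast hdeg
    · have hQx := abs_aeval_le_polySupNorm hE (Q (n + 1)) hx
      rw [hm, map_mul, aeval_C, map_prod, abs_mul, Finset.abs_prod, ← hm] at hQx
      simp_rw [map_pow, abs_pow] at hQx
      -- A nonzero integer content can only increase the norm, so dropping it keeps the bound.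
      have hc1 : 1 ≤ |algebraMap ℤ ℝ c| := by
        rw [eq_intCast, ← Int.cast_abs]
        exact_mod_cast Int.one_le_abs hc
      have hle : ∏ i, |aeval x (F i)| ^ m i ≤ s (n + 1) :=
        (le_mul_of_one_le_left (Finset.prod_nonneg fun i _ => by positivity) hc1).trans hQx
      have h1 := Real.rpow_le_rpow (Finset.prod_nonneg fun i _ => by positivity) hle
        (by positivity : (0 : ℝ) ≤ ((n + 1 : ℕ) : ℝ)⁻¹)
      rw [← Real.finsetProd_rpow _ _ fun i _ => by positivity] at h1
      refine le_trans (le_of_eq (Finset.prod_congr rfl fun i _ => ?_)) (h1.trans hn.le)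
      rw [Real.rpow_mul (abs_nonneg _), Real.rpow_natCast])
  obtain ⟨x, hxE, hx⟩ := exists_aeval_ne_zero_of_infinite hinf hF0
  have htpos : 0 < t := lt_of_lt_of_le
    (Finset.prod_pos fun i _ => Real.rpow_pos_of_pos (abs_pos.2 (hx i)) _) (hαE x hxE hx)
  have ht1 : t < 1 := by
    obtain ⟨P, hP0, hP⟩ := exists_int_polynomial_abs_lt_one hE hinf hcap
    -- The successor guarantees `N ≥ 1`, even for constant `P`.
    obtain ⟨y, hy, hyP⟩ := hlow (P.natDegree + 1) (by omega) P hP0 (by omega)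
    by_contra! h
    exact ((one_le_pow₀ h).trans hyP).not_gt (hP y hy)
  exact not_forall_prod_rpow_le hE htpos ht1 hlow hFd hα hαsum hαE
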